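/- Let $\mathscr{H}^\infty$ denote the set of bounded analytic functions $f$ in the right half-plane $\{s=\sigma+it : \sigma>0\}$ that can be represented as a convergent Dirichlet series $f(s)=\sum_{n=1}^\infty a_n n^{-s}$ in $\{\sigma>\kappa\}$ for some $\kappa>0$. For such $f$, set $f(+\infty)=a_1$ and $f(i\tau)=\lim_{\sigma\to0^+}f(\sigma+i\tau)$. Fix $1\le p<\infty$ and suppose that $f$ is in $\mathscr{H}^\infty$. Then $f(i\tau)$ exists for almost every real $\tau$, the integrals below are finite for every $T>0$, and \[\lim_{T\to\infty}\left|\frac{1}{2T}\int_{-T}^{T}|f(i\tau)|^p\,d\tau-|f(+\infty)|^p-\frac{p^2}{2T}\int_0^\infty\int_{-T}^{T}|f(\sigma+it)|^{p-2}\,|f'(\sigma+it)|^2\,\sigma\,dt\,d\sigma\right|=0.\] If $f\equiv0$, the integrand of the last integral is read as $0$. -/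

import Mathlib

open MeasureTheory Filter Topology Set

/-- The Dirichlet series `∑_{n ≥ 1} a n * n ^ (-s)` converges (as a limit of partial sums, not
necessarily absolutely) to `f s` in the half-plane `κ < Re s`, for some `κ > 0`.
The value `a 0` plays no role. -/
def HasDirichletSeries (f : ℂ → ℂ) (a : ℕ → ℂ) : Prop :=
  ∃ κ : ℝ, 0 < κ ∧ ∀ s : ℂ, κ < s.re →
    Tendsto (fun N : ℕ => ∑ n ∈ Finset.Icc 1 N, a n * (n : ℂ) ^ (-s)) atTop (𝓝 (f s))

/-- `f` belongs to `𝓗^∞`: it is a bounded analytic function in the right half-plane `0 < Re s`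
that can be represented as a convergent Dirichlet series in some half-plane `κ < Re s`, `κ > 0`.
The values of `f` outside the open right half-plane play no role. -/
structure MemHInfty (f : ℂ → ℂ) : Prop where
  analytic : DifferentiableOn ℂ f {s : ℂ | 0 < s.re}
  bounded : ∃ C : ℝ, ∀ s : ℂ, 0 < s.re → ‖f s‖ ≤ C
  dirichlet : ∃ a : ℕ → ℂ, HasDirichletSeries f a

/-- The boundary value `f(iτ) = lim_{σ → 0⁺} f(σ + iτ)` (an unspecified number where the limit
does not exist). -/
noncomputable def boundaryValue (f : ℂ → ℂ) (τ : ℝ) : ℂ :=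
  limUnder (𝓝[>] (0 : ℝ)) (fun σ : ℝ => f ((σ : ℂ) + (τ : ℂ) * Complex.I))

/-- The Littlewood-Paley density `|f(s)|^(p-2) |f'(s)|^2 σ` at `s = σ + it`. -/
noncomputable def lpDensity (p : ℝ) (f : ℂ → ℂ) (σ t : ℝ) : ℝ :=
  ‖f ((σ : ℂ) + (t : ℂ) * Complex.I)‖ ^ (p - 2) *
    ‖deriv f ((σ : ℂ) + (t : ℂ) * Complex.I)‖ ^ 2 * σ

/-!
For holomorphic `f` one has `Δ |f|^p = p² |f|^(p-2) |f'|²`, so the double integral is the integral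
of `σ Δ |f|^p` over a half-strip. Green's formula on the rectangle `[ε, S] × [-T, T]` with the
weight `σ - ε` turns it into boundary terms (`green_rectangle`). As the weight vanishes on `σ = ε`,
that side contributes just the integral of `|f(ε + it)|^p`, and no control of `f'` near the
imaginary axis is needed; the side `σ = S` contributes `-2T |a 1|^p` in the limit `S → ∞`. On the
horizontal sides the integrand is at most a constant times `σ |f'|`, because `p ≥ 1`; as `f` is
bounded and tends to `a 1` exponentially fast, Cauchy's estimate gives
`σ |f'(s)| ≤ K exp (-σ / 4)` (`re_mul_norm_deriv_le`). Hence the horizontal sides contribute `O(1)`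
uniformly in `T`, and the Littlewood-Paley identity holds up to `O(1)`
(`MemHInfty.exists_littlewoodPaley_bound`); dividing by `2T` gives the result. No almost periodicity
is used beyond the uniform limit at `+∞`.

The zeros of `f` are dealt with by replacing `|f|^p` with the smooth subharmonic function
`(|f|² + δ)^(p/2)`. With `δ = ε = 1 / (n + 1)` and `S = n + 1`, Fatou's lemma gives integrability of
the limit density for every exponent `≥ 1`, and dominated convergence then gives convergence of the
integrals, with a multiple of the density of exponent `min p 2` as majorant
(`approxDensity_le_lpDensity_min`).

The existence of boundary values (`MemHInfty.ae_tendsto_boundaryValue`) is reduced to the almost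
everywhere differentiability of Lipschitz functions of one real variable. Since `f` is bounded, it
has a primitive `g` that is Lipschitz up to the imaginary axis. At a point `iτ` where `g` is
differentiable along the axis, the Phragmén-Lindelöf principle applied to the remainder of the
first order expansion of `g` shows that this expansion is valid in the half-plane
(`norm_le_of_boundary_small`), and Cauchy's estimate shows that `f = g'` has a horizontal limit.
-/

/-! ### The half-plane -/

/-- The open right half-plane `{0 < Re s}`. -/
def rightHalfPlane : Set ℂ := {s : ℂ | 0 < s.re}

theorem isOpen_rightHalfPlane : IsOpen rightHalfPlane :=
  isOpen_lt continuous_const Complex.continuous_re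

theorem convex_rightHalfPlane : Convex ℝ rightHalfPlane :=
  convex_halfSpace_re_gt 0

theorem half_re_le_of_mem_closedBall {s z : ℂ} (hz : z ∈ Metric.closedBall s (s.re / 2)) :
    s.re / 2 ≤ z.re := by
  have h1 := (Complex.abs_re_le_norm (z - s)).trans (mem_closedBall_iff_norm.1 hz)
  rw [Complex.sub_re, abs_le] at h1
  linarith [h1.1]

/-! ### Decay of the function and of its derivative as `Re s → ∞` -/

theorem HasDirichletSeries.exists_decay_of_large_re {f : ℂ → ℂ} {a : ℕ → ℂ}
    (ha : HasDirichletSeries f a) :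
    ∃ σ₀ K : ℝ, ∀ s : ℂ, σ₀ ≤ s.re → ‖f s - a 1‖ ≤ K * Real.exp (-s.re / 2) := by
  obtain ⟨κ, hκ, h⟩ := ha
  set x₀ : ℝ := κ + 1 with hx₀
  -- the terms of the convergent series at `x₀` are bounded
  obtain ⟨B, hB⟩ : ∃ B : ℝ, ∀ n : ℕ, 1 ≤ n → ‖a n‖ ≤ B * (n : ℝ) ^ x₀ := by
    have h0 := h (x₀ : ℂ) (by simp [hx₀])
    have h1 := (h0.comp (tendsto_add_atTop_nat 1)).sub h0
    have h2 := h1.norm.bddAbove_range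
    obtain ⟨B, hB⟩ := h2
    refine ⟨B, fun n hn => ?_⟩
    obtain ⟨m, rfl⟩ : ∃ m, n = m + 1 := ⟨n - 1, by omega⟩
    have h3 := hB ⟨m, rfl⟩
    simp only [Function.comp_apply, Finset.sum_Icc_succ_top (Nat.le_add_left 1 m),
      add_sub_cancel_left, norm_mul] at h3
    rw [Complex.norm_natCast_cpow_of_pos (Nat.succ_pos m)] at h3
    have hp : (0 : ℝ) < ((m + 1 : ℕ) : ℝ) := by positivity
    simp only [Complex.neg_re, Complex.ofReal_re, Real.rpow_neg hp.le] at h3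
    rwa [← div_eq_mul_inv, div_le_iff₀ (by positivity)] at h3
  have hB0 : 0 ≤ B := by
    have := hB 1 le_rfl
    simp at this
    exact (norm_nonneg _).trans this
  have hsum : Summable fun n : ℕ => (n : ℝ) ^ (-2 : ℝ) :=
    Real.summable_nat_rpow.2 (by norm_num)
  set Z : ℝ := ∑' n : ℕ, (n : ℝ) ^ (-2 : ℝ) with hZ
  refine ⟨x₀ + 2, B * Z * (2 : ℝ) ^ (x₀ + 2), fun s hs => ?_⟩
  have hpart : ∀ N : ℕ, 1 ≤ N →
      ‖(∑ n ∈ Finset.Icc 1 N, a n * (n : ℂ) ^ (-s)) - a 1‖ ≤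
        B * Z * (2 : ℝ) ^ (x₀ + 2 - s.re) := by
    intro N hN
    have e : (∑ n ∈ Finset.Icc 1 N, a n * (n : ℂ) ^ (-s)) - a 1 =
        ∑ n ∈ Finset.Ioc 1 N, a n * (n : ℂ) ^ (-s) := by
      rw [← Finset.sum_Ioc_add_eq_sum_Icc (f := fun n : ℕ => a n * (n : ℂ) ^ (-s)) hN]
      simp
    rw [e]
    calc ‖∑ n ∈ Finset.Ioc 1 N, a n * (n : ℂ) ^ (-s)‖
        ≤ ∑ n ∈ Finset.Ioc 1 N, B * (2 : ℝ) ^ (x₀ + 2 - s.re) * (n : ℝ) ^ (-2 : ℝ) := by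
          refine norm_sum_le_of_le _ fun n hn => ?_
          rw [Finset.mem_Ioc] at hn
          have hn0 : (0 : ℝ) < n := by exact_mod_cast (by omega : 0 < n)
          have hn2 : (2 : ℝ) ≤ n := by exact_mod_cast hn.1
          rw [norm_mul, Complex.norm_natCast_cpow_of_pos (by omega), Complex.neg_re]
          calc ‖a n‖ * (n : ℝ) ^ (-s.re) ≤ B * (n : ℝ) ^ x₀ * (n : ℝ) ^ (-s.re) := by
                gcongr
                exact hB n (by omega)
            _ = B * (n : ℝ) ^ (x₀ + 2 - s.re) * (n : ℝ) ^ (-2 : ℝ) := by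
                rw [mul_assoc, mul_assoc, ← Real.rpow_add hn0, ← Real.rpow_add hn0]
                ring_nf
            _ ≤ _ := by
                gcongr B * ?_ * _
                exact Real.rpow_le_rpow_of_nonpos (by norm_num) hn2 (by linarith)
      _ = B * (2 : ℝ) ^ (x₀ + 2 - s.re) * ∑ n ∈ Finset.Ioc 1 N, (n : ℝ) ^ (-2 : ℝ) := by
          rw [Finset.mul_sum]
      _ ≤ B * (2 : ℝ) ^ (x₀ + 2 - s.re) * Z := by
          gcongr
          exact hsum.sum_le_tsum _ fun n _ => by positivity
      _ = _ := by ring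
  have hlim : ‖f s - a 1‖ ≤ B * Z * (2 : ℝ) ^ (x₀ + 2 - s.re) :=
    le_of_tendsto ((h s (by linarith)).sub_const (a 1)).norm
      (eventually_atTop.2 ⟨1, hpart⟩)
  refine hlim.trans ?_
  have hZ0 : 0 ≤ Z := tsum_nonneg fun n => by positivity
  have h2 : (2 : ℝ) ^ (-s.re) ≤ Real.exp (-s.re / 2) := by
    rw [Real.rpow_def_of_pos (by norm_num)]
    -- `1 / 2 < log 2`
    refine Real.exp_le_exp.2 ?_
    nlinarith [Real.log_two_gt_d9]
  rw [sub_eq_add_neg, Real.rpow_add (by norm_num), ← mul_assoc]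
  gcongr

/-- A function in `𝓗^∞` tends to its constant coefficient exponentially fast. -/
theorem MemHInfty.exists_decay {f : ℂ → ℂ} {a : ℕ → ℂ} (hf : MemHInfty f)
    (ha : HasDirichletSeries f a) :
    ∃ K : ℝ, 0 ≤ K ∧ ∀ s ∈ rightHalfPlane, ‖f s - a 1‖ ≤ K * Real.exp (-s.re / 2) := by
  obtain ⟨σ₀, K, hK⟩ := ha.exists_decay_of_large_re
  obtain ⟨C, hC⟩ := hf.bounded
  have hC0 : 0 ≤ C := (norm_nonneg _).trans (hC 1 (by simp))
  refine ⟨max K 0 + (C + ‖a 1‖) * Real.exp (|σ₀| / 2), by positivity, fun s hs => ?_⟩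
  have hexp := Real.exp_pos (-s.re / 2)
  rcases le_total σ₀ s.re with h | h
  · refine (hK s h).trans ?_
    gcongr
    exact (le_max_left _ _).trans (le_add_of_nonneg_right (by positivity))
  · calc ‖f s - a 1‖ ≤ ‖f s‖ + ‖a 1‖ := norm_sub_le _ _
      _ ≤ (C + ‖a 1‖) * 1 := by rw [mul_one]; gcongr; exact hC s hs
      _ ≤ (C + ‖a 1‖) * (Real.exp (|σ₀| / 2) * Real.exp (-s.re / 2)) := by
          gcongr
          rw [← Real.exp_add, Real.one_le_exp_iff]
          linarith [le_abs_self σ₀]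
      _ ≤ _ := by
          rw [← mul_assoc]
          gcongr
          exact le_add_of_nonneg_left (le_max_right _ _)

/-- Cauchy's estimate on the disc of radius `Re s / 2` around `s`. -/
theorem re_mul_norm_deriv_le {f : ℂ → ℂ} (hf : DifferentiableOn ℂ f rightHalfPlane) {c : ℂ} {K : ℝ}
    (hK0 : 0 ≤ K) (hK : ∀ s ∈ rightHalfPlane, ‖f s - c‖ ≤ K * Real.exp (-s.re / 2))
    {s : ℂ} (hs : s ∈ rightHalfPlane) :
    s.re * ‖deriv f s‖ ≤ 2 * K * Real.exp (-s.re / 4) := by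
  have hs' : 0 < s.re := hs
  have hsub : Metric.closedBall s (s.re / 2) ⊆ rightHalfPlane := fun z hz =>
    (half_pos hs').trans_le (half_re_le_of_mem_closedBall hz)
  have hd : DiffContOnCl ℂ (fun z => f z - c) (Metric.ball s (s.re / 2)) :=
    ((hf.mono hsub).sub_const c).diffContOnCl_ball subset_rfl
  have h := Complex.norm_deriv_le_of_forall_mem_sphere_norm_le (half_pos hs') hd
    (C := K * Real.exp (-s.re / 4)) fun z hz => by
      have hz' := Metric.sphere_subset_closedBall hz
      refine (hK z (hsub hz')).trans (mul_le_mul_of_nonneg_left (Real.exp_le_exp.2 ?_) hK0)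
      linarith [half_re_le_of_mem_closedBall hz']
  rw [deriv_sub_const, le_div_iff₀ (half_pos hs')] at h
  linarith

/-! ### Boundary values -/

/-- If `f - c` decays exponentially, then `c s - ∫₀^∞ (f (s + x) - c) dx` is a primitive of `f`. -/
theorem hasDerivAt_primitive {f : ℂ → ℂ} (hf : DifferentiableOn ℂ f rightHalfPlane) {c : ℂ} {K : ℝ}
    (hK0 : 0 ≤ K) (hK : ∀ s ∈ rightHalfPlane, ‖f s - c‖ ≤ K * Real.exp (-s.re / 2))
    {s : ℂ} (hs : s ∈ rightHalfPlane) :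
    HasDerivAt (fun z : ℂ => c * z - ∫ x in Ioi (0 : ℝ), (f (z + x) - c)) (f s) s := by
  have hs' : 0 < s.re := hs
  have hmem : ∀ z ∈ rightHalfPlane, ∀ x ∈ Ioi (0 : ℝ), z + (x : ℂ) ∈ rightHalfPlane := by
    intro z hz x hx
    have : 0 < z.re := hz
    have hx' : 0 < x := hx
    simp only [rightHalfPlane, mem_ofPred_eq, Complex.add_re, Complex.ofReal_re]
    linarith
  have hcont : ∀ z ∈ rightHalfPlane, ContinuousOn (fun x : ℝ => f (z + x) - c) (Ioi 0) :=
    fun z hz => ((hf.continuousOn.comp (by fun_prop) (hmem z hz)).sub continuousOn_const)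
  have hcont' : ContinuousOn (fun x : ℝ => deriv f (s + x)) (Ioi 0) :=
    ((hf.deriv isOpen_rightHalfPlane).continuousOn.comp (by fun_prop) (hmem s hs))
  have hintexp : ∀ b : ℝ, 0 < b → ∀ C : ℝ,
      IntegrableOn (fun x : ℝ => C * Real.exp (-b * x)) (Ioi 0) := fun b hb C =>
    (integrableOn_exp_mul_Ioi (neg_neg_of_pos hb) 0).const_mul C
  have hint : IntegrableOn (fun x : ℝ => f (s + x) - c) (Ioi 0) := by
    refine Integrable.mono' (hintexp (1 / 2) (by norm_num) K)
      ((hcont s hs).aestronglyMeasurable measurableSet_Ioi) ?_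
    refine (ae_restrict_iff' measurableSet_Ioi).2 (ae_of_all _ fun x hx => ?_)
    refine (hK _ (hmem s hs x hx)).trans ?_
    gcongr
    simp only [Complex.add_re, Complex.ofReal_re]
    linarith
  have hdiff : ∀ z ∈ rightHalfPlane, ∀ x ∈ Ioi (0 : ℝ),
      HasDerivAt (fun w : ℂ => f (w + x) - c) (deriv f (z + x)) z := fun z hz x hx =>
    (((hf.differentiableAt (isOpen_rightHalfPlane.mem_nhds (hmem z hz x hx))).hasDerivAt.comp_add_const
      z (x : ℂ)).sub_const c)
  have hball : Metric.closedBall s (s.re / 2) ⊆ rightHalfPlane := fun z hz =>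
    (half_pos hs').trans_le (half_re_le_of_mem_closedBall hz)
  have key := hasDerivAt_integral_of_dominated_loc_of_deriv_le
    (F := fun (z : ℂ) (x : ℝ) => f (z + x) - c) (F' := fun (z : ℂ) (x : ℝ) => deriv f (z + x))
    (μ := volume.restrict (Ioi 0)) (x₀ := s)
    (bound := fun x : ℝ => (2 * K / (s.re / 2)) * Real.exp (-(1 / 4) * x))
    (Metric.closedBall_mem_nhds s (half_pos hs'))
    (by
      filter_upwards [isOpen_rightHalfPlane.mem_nhds hs] with z hz
      exact (hcont z hz).aestronglyMeasurable measurableSet_Ioi)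
    hint (hcont'.aestronglyMeasurable measurableSet_Ioi)
    (by
      refine (ae_restrict_iff' measurableSet_Ioi).2 (ae_of_all _ fun x hx z hz => ?_)
      have hx' : 0 < x := hx
      have h1 := re_mul_norm_deriv_le hf hK0 hK (hmem z (hball hz) x hx)
      have h2 := half_re_le_of_mem_closedBall hz
      simp only [Complex.add_re, Complex.ofReal_re] at h1
      rw [div_mul_eq_mul_div, le_div_iff₀ (half_pos hs'), mul_comm]
      calc s.re / 2 * ‖deriv f (z + x)‖ ≤ (z.re + x) * ‖deriv f (z + x)‖ := by
            gcongr
            linarith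
        _ ≤ _ := h1
        _ ≤ _ := by
            gcongr
            linarith)
    (hintexp (1 / 4) (by norm_num) _)
    ((ae_restrict_iff' measurableSet_Ioi).2 (ae_of_all _ fun x hx z hz =>
      hdiff z (hball hz) x hx))
  -- `f (s + x) - c` vanishes as `x → ∞`, so only the endpoint `x = 0` contributes
  have hval : ∫ x in Ioi (0 : ℝ), deriv f (s + x) = 0 - (f s - c) := by
    have hsc : ContinuousAt f s :=
      (hf.differentiableAt (isOpen_rightHalfPlane.mem_nhds hs)).continuousAt
    have hlim : Tendsto (fun x : ℝ => f (s + x) - c) atTop (𝓝 0) := by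
      refine squeeze_zero_norm' (a := fun x : ℝ => K * Real.exp (-(1 / 2) * x)) ?_ ?_
      · filter_upwards [eventually_gt_atTop (0 : ℝ)] with x hx
        refine (hK _ (hmem s hs x hx)).trans ?_
        gcongr
        simp only [Complex.add_re, Complex.ofReal_re]
        linarith
      · have : Tendsto (fun x : ℝ => -(1 / 2 : ℝ) * x) atTop atBot :=
          tendsto_id.const_mul_atTop_of_neg (by norm_num)
        simpa using (Real.tendsto_exp_atBot.comp this).const_mul K
    have hc0 : ContinuousWithinAt (fun x : ℝ => f (s + x) - c) (Ici 0) 0 := by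
      refine ContinuousAt.continuousWithinAt ?_
      refine ContinuousAt.sub ?_ continuousAt_const
      exact ContinuousAt.comp (f := fun x : ℝ => s + (x : ℂ)) (by simpa using hsc) (by fun_prop)
    have h := integral_Ioi_of_hasDerivAt_of_tendsto hc0
      (fun x hx => ((hf.differentiableAt (isOpen_rightHalfPlane.mem_nhds
        (hmem s hs x hx))).hasDerivAt.comp_const_add s (x : ℂ)).comp_ofReal.sub_const c) key.1 hlim
    simpa using h
  have h := ((hasDerivAt_id s).const_mul c).sub key.2
  refine h.congr_deriv ?_
  rw [hval]
  ring

/-- A bounded function in the half-plane that decays exponentially to a constant has a primitive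
which extends to a Lipschitz function on `ℂ`. -/
theorem exists_lipschitz_primitive {f : ℂ → ℂ} (hf : DifferentiableOn ℂ f rightHalfPlane)
    {c : ℂ} {K : ℝ}
    (hK0 : 0 ≤ K) (hK : ∀ s ∈ rightHalfPlane, ‖f s - c‖ ≤ K * Real.exp (-s.re / 2)) :
    ∃ (g : ℂ → ℂ) (L : NNReal), LipschitzWith L g ∧ ∀ s ∈ rightHalfPlane, HasDerivAt g (f s) s := by
  have hM : 0 ≤ K + ‖c‖ := by positivity
  have hLip : LipschitzOnWith ⟨K + ‖c‖, hM⟩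
      (fun z : ℂ => c * z - ∫ x in Ioi (0 : ℝ), (f (z + x) - c)) rightHalfPlane := by
    refine convex_rightHalfPlane.lipschitzOnWith_of_nnnorm_hasDerivWithin_le
      (fun s hs => (hasDerivAt_primitive hf hK0 hK hs).hasDerivWithinAt) fun s hs => ?_
    have hs' : 0 < s.re := hs
    change ‖f s‖ ≤ K + ‖c‖
    calc ‖f s‖ = ‖(f s - c) + c‖ := by rw [sub_add_cancel]
      _ ≤ K * Real.exp (-s.re / 2) + ‖c‖ := (norm_add_le _ _).trans (by gcongr; exact hK s hs)
      _ ≤ K * 1 + ‖c‖ := by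
          gcongr
          exact Real.exp_le_one_iff.2 (by linarith)
      _ = _ := by rw [mul_one]
  obtain ⟨g, hg, hgs⟩ := hLip.extend_finite_dimension
  refine ⟨g, _, hg, fun s hs => (hasDerivAt_primitive hf hK0 hK hs).congr_of_eventuallyEq ?_⟩
  filter_upwards [isOpen_rightHalfPlane.mem_nhds hs] with z hz using (hgs hz).symm

/-- A Lindelöf-type estimate at the boundary point `0`: smallness of `G z / z` along the imaginary
axis passes to the half-plane. -/
theorem norm_le_of_boundary_small {G : ℂ → ℂ} (hG : DiffContOnCl ℂ G rightHalfPlane) {L : ℝ}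
    (hL : ∀ z, ‖G z‖ ≤ L * ‖z‖) {η r : ℝ} (hη : 0 < η) (hr : 0 < r)
    (hb : ∀ y : ℝ, |y| < r → ‖G (y * Complex.I)‖ ≤ η * |y|) :
    ∃ N : ℝ, 0 < N ∧ ∀ z ∈ rightHalfPlane, ‖G z‖ ≤ η * ‖z‖ * ‖1 + N * z‖ := by
  have hL0 : 0 ≤ L := by simpa using (norm_nonneg _).trans (hL 1)
  set N : ℝ := (L + 1) / (η * r) with hN
  have hN0 : 0 < N := by positivity
  refine ⟨N, hN0, ?_⟩
  -- the factor `1 + N z` is harmless near `0` and absorbs the constant `L` on `r ≤ |Im z|`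
  have hpos : ∀ ε : ℝ, 0 < ε → ∀ z : ℂ, 0 ≤ z.re → ε ≤ ‖z + ε‖ ∧ ‖z‖ ≤ ‖z + ε‖ ∧
      1 ≤ ‖1 + N * z‖ ∧ N * ‖z‖ ≤ ‖1 + N * z‖ := by
    intro ε hε z hz
    have key : ∀ x : ℝ, 0 ≤ x → ∀ w : ℂ, 0 ≤ w.re → x ≤ ‖w + x‖ ∧ ‖w‖ ≤ ‖w + x‖ := by
      intro x hx w hw
      constructor
      · have := Complex.re_le_norm (w + x)
        simp at this
        linarith
      · rw [← abs_of_nonneg (norm_nonneg w), ← abs_of_nonneg (norm_nonneg (w + x)), ← sq_le_sq,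
          ← Complex.normSq_eq_norm_sq, ← Complex.normSq_eq_norm_sq, Complex.normSq_apply,
          Complex.normSq_apply]
        simp only [Complex.add_re, Complex.ofReal_re, Complex.add_im, Complex.ofReal_im, add_zero]
        nlinarith [mul_nonneg hx hw]
    have h1 := key ε hε.le z hz
    have h2 := key 1 zero_le_one (N * z) (by simp; positivity)
    rw [norm_mul, Complex.norm_real, Real.norm_of_nonneg hN0.le, add_comm (_ : ℂ),
      Complex.ofReal_one] at h2
    exact ⟨h1.1, h1.2, h2.1, h2.2⟩
  -- dividing by `z + ε` instead of `z` keeps the quotient continuous on the closed half-plane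
  have main : ∀ ε : ℝ, 0 < ε → ∀ z ∈ rightHalfPlane,
      ‖G z‖ ≤ η * ‖z + ε‖ * ‖1 + N * z‖ := by
    intro ε hε z hz
    have hclos : closure rightHalfPlane = {z : ℂ | 0 ≤ z.re} := Complex.closure_setOfPred_lt_re 0
    have hbound : ∀ w : ℂ, 0 ≤ w.re →
        ‖((w + ε) * (1 + N * w))⁻¹ * G w‖ ≤ L * ‖1 + N * w‖⁻¹ := by
      intro w hw
      obtain ⟨h1, h2, h3, h4⟩ := hpos ε hε w hw
      rw [norm_mul, norm_inv, norm_mul, mul_inv]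
      have : ‖G w‖ ≤ L * ‖w + ε‖ := (hL w).trans (by gcongr)
      calc ‖w + ε‖⁻¹ * ‖1 + N * w‖⁻¹ * ‖G w‖ ≤ ‖w + ε‖⁻¹ * ‖1 + N * w‖⁻¹ * (L * ‖w + ε‖) := by
            gcongr
        _ = _ := by
            have : ‖w + ε‖ ≠ 0 := by linarith
            field_simp
    have hPL := PhragmenLindelof.right_half_plane_of_tendsto_zero_on_real
      (f := fun w : ℂ => ((w + ε) * (1 + N * w))⁻¹ * G w) (C := η) (z := z) ?_ ?_ ?_ ?_ (le_of_lt hz)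
    · obtain ⟨h1, h2, h3, h4⟩ := hpos ε hε z (le_of_lt hz)
      rw [norm_mul, norm_inv, norm_mul,
        inv_mul_le_iff₀ (mul_pos (hε.trans_le h1) (one_pos.trans_le h3))] at hPL
      linarith
    · refine DiffContOnCl.smul (DiffContOnCl.inv ?_ ?_) hG
      · exact Differentiable.diffContOnCl (by fun_prop)
      · intro w hw
        rw [hclos] at hw
        obtain ⟨h1, h2, h3, h4⟩ := hpos ε hε w hw
        rw [← norm_pos_iff, norm_mul]
        exact mul_pos (hε.trans_le h1) (one_pos.trans_le h3)
    · refine ⟨1, by norm_num, 0, ?_⟩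
      refine Asymptotics.IsBigO.of_bound L ?_
      filter_upwards [mem_inf_of_right (mem_principal_self _)] with w hw
      refine (hbound w (le_of_lt hw)).trans ?_
      obtain ⟨h1, h2, h3, h4⟩ := hpos ε hε w (le_of_lt hw)
      simp only [zero_mul, Real.exp_zero, norm_one]
      gcongr
      exact inv_le_one_of_one_le₀ h3
    · refine squeeze_zero_norm' (a := fun x : ℝ => L * (N * x)⁻¹) ?_ ?_
      · filter_upwards [eventually_gt_atTop 0] with x hx
        have hx' : 0 ≤ ((x : ℝ) : ℂ).re := by simpa using hx.le
        obtain ⟨h1, h2, h3, h4⟩ := hpos ε hε x hx'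
        refine (hbound x hx').trans ?_
        rw [Complex.norm_real, Real.norm_of_nonneg hx.le] at h4
        gcongr
      · simpa using ((tendsto_id.const_mul_atTop hN0).inv_tendsto_atTop).const_mul L
    · intro y
      have hy : 0 ≤ ((y : ℂ) * Complex.I).re := by simp
      obtain ⟨h1, h2, h3, h4⟩ := hpos ε hε _ hy
      have hny : ‖(y : ℂ) * Complex.I‖ = |y| := by simp
      rcases lt_or_ge |y| r with h | h
      · rw [norm_mul, norm_inv, norm_mul,
          inv_mul_le_iff₀ (mul_pos (hε.trans_le h1) (one_pos.trans_le h3))]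
        calc ‖G (y * Complex.I)‖ ≤ η * |y| := hb y h
          _ ≤ ‖(y : ℂ) * Complex.I + ε‖ * 1 * η := by
              rw [mul_comm, mul_one, ← hny]
              gcongr
          _ ≤ _ := by gcongr
      · refine (hbound _ hy).trans ?_
        rw [hny] at h4
        have h5 : N * r ≤ ‖1 + N * ((y : ℂ) * Complex.I)‖ := le_trans (by gcongr) h4
        rw [← div_eq_mul_inv, div_le_iff₀ (by positivity)]
        calc L ≤ η * (N * r) := by
              rw [hN]
              field_simp
              linarith
          _ ≤ _ := by gcongr
  intro z hz
  have hlim : Tendsto (fun ε : ℝ => η * ‖z + ε‖ * ‖1 + N * z‖) (𝓝[>] 0)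
      (𝓝 (η * ‖z + (0 : ℝ)‖ * ‖1 + N * z‖)) :=
    (Continuous.tendsto (by fun_prop) 0).mono_left nhdsWithin_le_nhds
  rw [Complex.ofReal_zero, add_zero] at hlim
  exact ge_of_tendsto hlim (eventually_nhdsWithin_of_forall fun ε hε => main ε hε z hz)

/-- If a Lipschitz primitive of `f` is differentiable along the imaginary axis at `iτ`, then `f`
has a horizontal limit there. -/
theorem exists_tendsto_of_primitive_differentiableAt {f g : ℂ → ℂ} {L : NNReal}
    (hg : LipschitzWith L g)
    (hgf : ∀ s ∈ rightHalfPlane, HasDerivAt g (f s) s) {τ : ℝ}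
    (hτ : DifferentiableAt ℝ (fun y : ℝ => g (y * Complex.I)) τ) :
    ∃ A : ℂ, Tendsto (fun σ : ℝ => f ((σ : ℂ) + (τ : ℂ) * Complex.I)) (𝓝[>] (0 : ℝ)) (𝓝 A) := by
  -- the derivative of `y ↦ g (y I)` is `I` times the complex derivative
  set A : ℂ := -Complex.I * deriv (fun y : ℝ => g (y * Complex.I)) τ with hA
  refine ⟨A, ?_⟩
  set G : ℂ → ℂ := fun z => g (z + τ * Complex.I) - g (τ * Complex.I) - A * z with hGdef
  have hshift : ∀ z ∈ rightHalfPlane, z + τ * Complex.I ∈ rightHalfPlane := by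
    intro z hz
    simpa [rightHalfPlane] using hz
  have hGderiv : ∀ z ∈ rightHalfPlane, HasDerivAt G (f (z + τ * Complex.I) - A) z := by
    intro z hz
    have h := ((hgf _ (hshift z hz)).comp_add_const z (τ * Complex.I)).sub_const (g (τ * Complex.I))
    exact (h.sub ((hasDerivAt_id z).const_mul A)).congr_deriv (by rw [mul_one])
  have hGcont : Continuous G := by
    have := hg.continuous
    fun_prop
  have hGd : DiffContOnCl ℂ G rightHalfPlane :=
    ⟨fun z hz => (hGderiv z hz).differentiableAt.differentiableWithinAt, hGcont.continuousOn⟩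
  have hGL : ∀ z, ‖G z‖ ≤ (L + ‖A‖) * ‖z‖ := by
    intro z
    have h := hg.dist_le_mul (z + τ * Complex.I) (τ * Complex.I)
    rw [dist_eq_norm, dist_eq_norm, add_sub_cancel_right] at h
    calc ‖G z‖ ≤ ‖g (z + τ * Complex.I) - g (τ * Complex.I)‖ + ‖A * z‖ := norm_sub_le _ _
      _ ≤ L * ‖z‖ + ‖A‖ * ‖z‖ := by rw [norm_mul]; gcongr
      _ = _ := by ring
  rw [Metric.tendsto_nhdsWithin_nhds]
  intro e he
  -- `‖G z‖ ≤ η (3σ / 2) 2` on the circle of radius `σ / 2` about `σ`, so Cauchy's estimate bounds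
  -- the derivative by `6 η = e / 2`
  set η : ℝ := e / 12 with hη
  have hη0 : 0 < η := by positivity
  have hd := hτ.hasDerivAt
  rw [hasDerivAt_iff_isLittleO_nhds_zero, Asymptotics.isLittleO_iff] at hd
  obtain ⟨r, hr, hr'⟩ := Metric.eventually_nhds_iff.1 (hd hη0)
  have hb : ∀ y : ℝ, |y| < r → ‖G (y * Complex.I)‖ ≤ η * |y| := by
    intro y hy
    have h := hr' (y := y) (by simpa using hy)
    rw [Real.norm_eq_abs] at h
    refine le_trans (le_of_eq ?_) h
    congr 1
    simp only [hGdef, hA, Complex.ofReal_add, Complex.real_smul]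
    rw [add_mul, add_comm (_ * _)]
    linear_combination (deriv (fun y : ℝ => g (y * Complex.I)) τ * y) * Complex.I_sq
  obtain ⟨N, hN, hGN⟩ := norm_le_of_boundary_small hGd hGL hη0 hr hb
  refine ⟨1 / (2 * N), by positivity, fun σ hσ hσ' => ?_⟩
  have hσ0 : 0 < σ := hσ
  rw [dist_zero_right, Real.norm_of_nonneg hσ0.le, lt_div_iff₀ (by positivity)] at hσ'
  have hσH : (σ : ℂ) ∈ rightHalfPlane := by simpa [rightHalfPlane] using hσ0
  have hre : (σ : ℂ).re = σ := Complex.ofReal_re σ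
  have hC := Complex.norm_deriv_le_of_forall_mem_sphere_norm_le (half_pos hσ0) (c := (σ : ℂ))
    (f := G) (C := η * (3 / 2 * σ) * 2)
    (hGd.mono fun z hz => ?_) fun z hz => ?_
  · rw [(hGderiv _ hσH).deriv, le_div_iff₀ (half_pos hσ0)] at hC
    rw [dist_eq_norm]
    nlinarith
  · have := half_re_le_of_mem_closedBall (s := σ) (z := z)
      (by rw [hre]; exact Metric.ball_subset_closedBall hz)
    rw [hre] at this
    exact (half_pos hσ0).trans_le this
  · have h1 := half_re_le_of_mem_closedBall (s := σ) (z := z)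
      (by rw [hre]; exact Metric.sphere_subset_closedBall hz)
    rw [hre] at h1
    have h2 : ‖z‖ ≤ 3 / 2 * σ := by
      have h3 := norm_le_norm_add_norm_sub' z (σ : ℂ)
      rw [mem_sphere_iff_norm.1 hz, Complex.norm_real, Real.norm_of_nonneg hσ0.le] at h3
      linarith
    refine (hGN z ((half_pos hσ0).trans_le h1)).trans ?_
    have h4 : ‖1 + N * z‖ ≤ 2 := by
      refine (norm_add_le _ _).trans ?_
      rw [norm_one, norm_mul, Complex.norm_real, Real.norm_of_nonneg hN.le]
      nlinarith
    gcongr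

/-- Fatou's theorem for `𝓗^∞`. -/
theorem MemHInfty.ae_tendsto_boundaryValue {f : ℂ → ℂ} (hf : MemHInfty f) :
    ∀ᵐ τ : ℝ, Tendsto (fun σ : ℝ => f ((σ : ℂ) + (τ : ℂ) * Complex.I)) (𝓝[>] (0 : ℝ))
      (𝓝 (boundaryValue f τ)) := by
  obtain ⟨a, ha⟩ := hf.dirichlet
  obtain ⟨K, hK0, hK⟩ := hf.exists_decay ha
  obtain ⟨g, L, hg, hgf⟩ := exists_lipschitz_primitive hf.analytic hK0 hK
  have hline : LipschitzWith 1 fun y : ℝ => (y : ℂ) * Complex.I :=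
    LipschitzWith.of_dist_le_mul fun x y => by
      rw [dist_eq_norm, dist_eq_norm, ← sub_mul, ← Complex.ofReal_sub, norm_mul,
        Complex.norm_I, Complex.norm_real]
      simp
  filter_upwards [(hg.comp hline).ae_differentiableAt_real] with τ hτ
  exact tendsto_nhds_limUnder (exists_tendsto_of_primitive_differentiableAt hg hgf hτ)

/-! ### Regularized powers and their Laplacian -/

/-- The smooth function `(|w|² + δ)^(p/2)`, which regularizes `|w|^p` at `w = 0`. -/
noncomputable def regPow (p δ : ℝ) (w : ℂ) : ℝ := (‖w‖ ^ 2 + δ) ^ (p / 2)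

/-- The derivative of `regPow p δ` at `w` in the direction `v`. -/
noncomputable def regPowDeriv (p δ : ℝ) (w v : ℂ) : ℝ :=
  p * (‖w‖ ^ 2 + δ) ^ (p / 2 - 1) * inner ℝ w v

/-- The second derivative of `regPow p δ` along a curve through `w` with velocity `v` and
acceleration `b`. -/
noncomputable def regPowDerivTwo (p δ : ℝ) (w v b : ℂ) : ℝ :=
  p * (p - 2) * (‖w‖ ^ 2 + δ) ^ (p / 2 - 2) * inner ℝ w v ^ 2 +
    p * (‖w‖ ^ 2 + δ) ^ (p / 2 - 1) * (‖v‖ ^ 2 + inner ℝ w b)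

/-- The Laplacian of `(|f|² + δ)^(p/2)` for holomorphic `f`, at a point where `f = w` and
`f' = v`. -/
noncomputable def regLaplacian (p δ : ℝ) (w v : ℂ) : ℝ :=
  (‖w‖ ^ 2 + δ) ^ (p / 2 - 2) * ‖v‖ ^ 2 * (p ^ 2 * ‖w‖ ^ 2 + 2 * p * δ)

theorem hasDerivAt_regPow {p δ : ℝ} (hδ : 0 < δ) {w : ℝ → ℂ} {v : ℂ} {x : ℝ}
    (hw : HasDerivAt w v x) :
    HasDerivAt (fun y => regPow p δ (w y)) (regPowDeriv p δ (w x) v) x := by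
  have hq : ‖w x‖ ^ 2 + δ ≠ 0 := by positivity
  refine ((hw.norm_sq.add_const δ).rpow_const (p := p / 2) (Or.inl hq)).congr_deriv ?_
  rw [regPowDeriv]
  ring

theorem hasDerivAt_regPowDeriv {p δ : ℝ} (hδ : 0 < δ) {w v : ℝ → ℂ} {b : ℂ} {x : ℝ}
    (hw : HasDerivAt w (v x) x) (hv : HasDerivAt v b x) :
    HasDerivAt (fun y => regPowDeriv p δ (w y) (v y)) (regPowDerivTwo p δ (w x) (v x) b) x := by
  have hq : ‖w x‖ ^ 2 + δ ≠ 0 := by positivity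
  refine ((((hw.norm_sq.add_const δ).rpow_const (p := p / 2 - 1) (Or.inl hq)).const_mul p).mul
    (hw.inner ℝ hv)).congr_deriv ?_
  rw [regPowDerivTwo, real_inner_self_eq_norm_sq, show p / 2 - 1 - 1 = p / 2 - 2 by ring]
  ring

theorem inner_sq_add_inner_I_mul_sq (w v : ℂ) :
    inner ℝ w v ^ 2 + inner ℝ w (Complex.I * v) ^ 2 = ‖w‖ ^ 2 * ‖v‖ ^ 2 := by
  rw [← Complex.normSq_eq_norm_sq, ← Complex.normSq_eq_norm_sq, Complex.normSq_apply,
    Complex.normSq_apply]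
  simp only [Complex.inner, Complex.mul_re, Complex.mul_im, Complex.conj_re, Complex.conj_im,
    Complex.I_re, Complex.I_im]
  ring

theorem regPowDerivTwo_add {p δ : ℝ} (hδ : 0 < δ) (w v b : ℂ) :
    regPowDerivTwo p δ w v b + regPowDerivTwo p δ w (Complex.I * v) (Complex.I * (Complex.I * b)) =
      regLaplacian p δ w v := by
  have hq : 0 < ‖w‖ ^ 2 + δ := by positivity
  have h1 : (‖w‖ ^ 2 + δ) ^ (p / 2 - 1) = (‖w‖ ^ 2 + δ) ^ (p / 2 - 2) * (‖w‖ ^ 2 + δ) := by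
    rw [← Real.rpow_add_one hq.ne']
    ring_nf
  have h2 := inner_sq_add_inner_I_mul_sq w v
  have h3 : ‖Complex.I * v‖ = ‖v‖ := by simp
  have h4 : inner ℝ w (Complex.I * (Complex.I * b)) = -inner ℝ w b := by
    rw [← mul_assoc, Complex.I_mul_I, neg_one_mul, inner_neg_right]
  rw [regPowDerivTwo, regPowDerivTwo, regLaplacian, h3, h4, h1]
  linear_combination p * (p - 2) * (‖w‖ ^ 2 + δ) ^ (p / 2 - 2) * h2

theorem regLaplacian_nonneg {p δ : ℝ} (hp : 0 ≤ p) (hδ : 0 ≤ δ) (w v : ℂ) :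
    0 ≤ regLaplacian p δ w v := by
  rw [regLaplacian]
  positivity

theorem regLaplacian_le {p δ : ℝ} (hp : 0 ≤ p) (hδ : 0 < δ) (w v : ℂ) :
    regLaplacian p δ w v ≤ (p ^ 2 + 2 * p) * ((‖w‖ ^ 2 + δ) ^ (p / 2 - 1) * ‖v‖ ^ 2) := by
  have hq : 0 < ‖w‖ ^ 2 + δ := by positivity
  have h1 : (‖w‖ ^ 2 + δ) ^ (p / 2 - 1) = (‖w‖ ^ 2 + δ) ^ (p / 2 - 2) * (‖w‖ ^ 2 + δ) := by
    rw [← Real.rpow_add_one hq.ne']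
    ring_nf
  rw [regLaplacian, h1]
  calc _ ≤ (‖w‖ ^ 2 + δ) ^ (p / 2 - 2) * ‖v‖ ^ 2 * ((p ^ 2 + 2 * p) * (‖w‖ ^ 2 + δ)) := by
        gcongr
        nlinarith [mul_nonneg hp (sq_nonneg ‖w‖), mul_nonneg (sq_nonneg p) hδ.le]
    _ = _ := by ring

theorem norm_regPowDeriv_le {p δ M : ℝ} (hp : 1 ≤ p) (hδ : 0 < δ) (hδ1 : δ ≤ 1) {w : ℂ}
    (hw : ‖w‖ ≤ M) (v : ℂ) :
    ‖regPowDeriv p δ w v‖ ≤ p * (M ^ 2 + 1) ^ ((p - 1) / 2) * ‖v‖ := by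
  have hq : 0 < ‖w‖ ^ 2 + δ := by positivity
  have h1 : ‖w‖ ≤ (‖w‖ ^ 2 + δ) ^ (1 / 2 : ℝ) := by
    rw [← Real.sqrt_eq_rpow]
    exact Real.le_sqrt_of_sq_le (by linarith)
  rw [regPowDeriv, norm_mul, norm_mul, Real.norm_of_nonneg (by linarith : 0 ≤ p),
    Real.norm_of_nonneg (by positivity), mul_assoc, mul_assoc]
  refine mul_le_mul_of_nonneg_left ?_ (by linarith)
  calc (‖w‖ ^ 2 + δ) ^ (p / 2 - 1) * ‖inner ℝ w v‖
      ≤ (‖w‖ ^ 2 + δ) ^ (p / 2 - 1) * ((‖w‖ ^ 2 + δ) ^ (1 / 2 : ℝ) * ‖v‖) := by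
        gcongr
        exact (norm_inner_le_norm w v).trans (by gcongr)
    _ = (‖w‖ ^ 2 + δ) ^ ((p - 1) / 2) * ‖v‖ := by
        rw [← mul_assoc, ← Real.rpow_add hq]
        ring_nf
    _ ≤ _ := by
        gcongr

theorem tendsto_regPow {p : ℝ} (hp : 0 < p) {w : ℕ → ℂ} {c : ℂ} {δ : ℕ → ℝ}
    (hw : Tendsto w atTop (𝓝 c)) (hδ : Tendsto δ atTop (𝓝 0)) :
    Tendsto (fun n => regPow p (δ n) (w n)) atTop (𝓝 (‖c‖ ^ p)) := by
  have h := ((hw.norm.pow 2).add hδ).rpow_const (p := p / 2) (Or.inr (by positivity))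
  rwa [add_zero, ← Real.rpow_natCast, ← Real.rpow_mul (norm_nonneg _),
    show ((2 : ℕ) : ℝ) * (p / 2) = p by push_cast; ring] at h

theorem norm_regPow_le {p δ M : ℝ} (hp : 0 ≤ p) (hδ : 0 ≤ δ) (hδ1 : δ ≤ 1) {w : ℂ} (hw : ‖w‖ ≤ M) :
    ‖regPow p δ w‖ ≤ (M ^ 2 + 1) ^ (p / 2) := by
  rw [regPow, Real.norm_of_nonneg (by positivity)]
  gcongr

theorem tendsto_regLaplacian {p : ℝ} {w v : ℂ} (h : w ≠ 0 ∨ v = 0) {δ : ℕ → ℝ}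
    (hδ : Tendsto δ atTop (𝓝 0)) :
    Tendsto (fun n => regLaplacian p (δ n) w v) atTop (𝓝 (p ^ 2 * (‖w‖ ^ (p - 2) * ‖v‖ ^ 2))) := by
  rcases h with h | h
  · have hw : 0 < ‖w‖ := norm_pos_iff.2 h
    have h1 : Tendsto (fun n => ‖w‖ ^ 2 + δ n) atTop (𝓝 (‖w‖ ^ 2)) := by
      simpa using hδ.const_add (‖w‖ ^ 2)
    have h2 := ((h1.rpow_const (p := p / 2 - 2) (Or.inl (by positivity))).mul_const
      (‖v‖ ^ 2)).mul ((hδ.const_mul (2 * p)).const_add (p ^ 2 * ‖w‖ ^ 2))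
    have h3 : (‖w‖ ^ 2) ^ (p / 2 - 2) * ‖w‖ ^ 2 = ‖w‖ ^ (p - 2) := by
      rw [← Real.rpow_natCast, ← Real.rpow_mul hw.le, ← Real.rpow_add hw]
      push_cast
      ring_nf
    rw [← h3]
    exact h2.trans (le_of_eq (by ring_nf))
  · simp [regLaplacian, h]

/-! ### Green's formula -/

/-- Green's formula on a rectangle against the weight `σ - ε`, which vanishes on the side
`σ = ε`. -/
theorem green_rectangle {u uσ ut uσσ utt : ℝ → ℝ → ℝ} {ε S T : ℝ} (hεS : ε ≤ S) (hT : 0 ≤ T)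
    (h1 : ∀ σ ∈ Icc ε S, ∀ t, HasDerivAt (fun x => u x t) (uσ σ t) σ)
    (h2 : ∀ σ ∈ Icc ε S, ∀ t, HasDerivAt (fun x => uσ x t) (uσσ σ t) σ)
    (h3 : ∀ σ ∈ Icc ε S, ∀ t, HasDerivAt (fun y => ut σ y) (utt σ t) t)
    (hcσ : ContinuousOn (fun z : ℝ × ℝ => uσσ z.1 z.2) (Icc ε S ×ˢ univ))
    (hct : ContinuousOn (fun z : ℝ × ℝ => utt z.1 z.2) (Icc ε S ×ˢ univ)) :
    IntegrableOn (fun z : ℝ × ℝ => (z.1 - ε) * (uσσ z.1 z.2 + utt z.1 z.2))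
      (Ioc ε S ×ˢ Ioc (-T) T) ∧
    ∫ z in Ioc ε S ×ˢ Ioc (-T) T, (z.1 - ε) * (uσσ z.1 z.2 + utt z.1 z.2) =
      (∫ t in (-T)..T, ((S - ε) * uσ S t - u S t + u ε t)) +
        ∫ σ in ε..S, (σ - ε) * (ut σ T - ut σ (-T)) := by
  have hTT : -T ≤ T := by linarith
  have hsub : Ioc ε S ×ˢ Ioc (-T) T ⊆ Icc ε S ×ˢ Icc (-T) T :=
    prod_mono Ioc_subset_Icc_self Ioc_subset_Icc_self
  have hsub' : Icc ε S ×ˢ Icc (-T) T ⊆ Icc ε S ×ˢ univ := prod_mono subset_rfl (subset_univ _)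
  have hint : ∀ k : ℝ → ℝ → ℝ, ContinuousOn (fun z : ℝ × ℝ => k z.1 z.2) (Icc ε S ×ˢ univ) →
      IntegrableOn (fun z : ℝ × ℝ => (z.1 - ε) * k z.1 z.2) (Ioc ε S ×ˢ Ioc (-T) T) := by
    intro k hk
    refine IntegrableOn.mono_set ?_ hsub
    refine ContinuousOn.integrableOn_compact (isCompact_Icc.prod isCompact_Icc) ?_
    exact ContinuousOn.mul (by fun_prop) (hk.mono hsub')
  have hi1 := hint uσσ hcσ
  have hi2 := hint utt hct
  have hcol : ∀ t, IntervalIntegrable (fun σ => uσσ σ t) volume ε S := by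
    intro t
    refine ContinuousOn.intervalIntegrable ?_
    rw [uIcc_of_le hεS]
    exact hcσ.comp (f := fun σ : ℝ => (σ, t)) (by fun_prop) fun σ hσ => ⟨hσ, mem_univ _⟩
  have hrow : ∀ σ ∈ Icc ε S, IntervalIntegrable (fun t => utt σ t) volume (-T) T := by
    intro σ hσ
    refine ContinuousOn.intervalIntegrable ?_
    exact hct.comp (f := fun t : ℝ => (σ, t)) (by fun_prop) fun t ht => ⟨hσ, mem_univ _⟩
  simp only [mul_add]
  refine ⟨hi1.add hi2, ?_⟩
  rw [integral_add hi1 hi2]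
  congr 1
  · rw [Measure.volume_eq_prod, ← Measure.prod_restrict, integral_prod_symm,
      intervalIntegral.integral_of_le hTT]
    · refine integral_congr_ae (ae_of_all _ fun t => ?_)
      simp only
      rw [← intervalIntegral.integral_of_le hεS]
      rw [intervalIntegral.integral_mul_deriv_eq_deriv_mul (u' := fun _ => 1)
        (v := fun σ => uσ σ t) (fun σ _ => (hasDerivAt_id' σ).sub_const ε)
        (by rw [uIcc_of_le hεS]; exact fun σ hσ => h2 σ hσ t)
        intervalIntegrable_const (hcol t)]
      simp only [one_mul]
      rw [intervalIntegral.integral_eq_sub_of_hasDerivAt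
        (by rw [uIcc_of_le hεS]; exact fun σ hσ => h1 σ hσ t)]
      · ring
      · refine ContinuousOn.intervalIntegrable ?_
        rw [uIcc_of_le hεS]
        exact fun σ hσ => (h2 σ hσ t).continuousAt.continuousWithinAt
    · rw [Measure.prod_restrict]
      exact hi1
  · rw [Measure.volume_eq_prod, setIntegral_prod _ hi2, intervalIntegral.integral_of_le hεS]
    refine setIntegral_congr_fun measurableSet_Ioc fun σ hσ => ?_
    have hσ' := Ioc_subset_Icc_self hσ
    simp only
    rw [integral_const_mul, ← intervalIntegral.integral_of_le hTT,
      intervalIntegral.integral_eq_sub_of_hasDerivAt (fun t _ => h3 σ hσ' t) (hrow σ hσ')]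

theorem hasDerivAt_horizontal {F : ℂ → ℂ} (hF : DifferentiableOn ℂ F rightHalfPlane) {σ t : ℝ}
    (hσ : 0 < σ) :
    HasDerivAt (fun x : ℝ => F (x + t * Complex.I)) (deriv F (σ + t * Complex.I)) σ := by
  have hs : (σ : ℂ) + t * Complex.I ∈ rightHalfPlane := by simpa [rightHalfPlane] using hσ
  exact ((hF.differentiableAt (isOpen_rightHalfPlane.mem_nhds hs)).hasDerivAt.comp_add_const
    (σ : ℂ) (t * Complex.I)).comp_ofReal

theorem hasDerivAt_vertical {F : ℂ → ℂ} (hF : DifferentiableOn ℂ F rightHalfPlane) {σ t : ℝ}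
    (hσ : 0 < σ) :
    HasDerivAt (fun y : ℝ => F (σ + y * Complex.I)) (Complex.I * deriv F (σ + t * Complex.I)) t := by
  have hs : (σ : ℂ) + t * Complex.I ∈ rightHalfPlane := by simpa [rightHalfPlane] using hσ
  have h1 : HasDerivAt (fun y : ℂ => (σ : ℂ) + y * Complex.I) Complex.I (t : ℂ) := by
    simpa using ((hasDerivAt_id (t : ℂ)).mul_const Complex.I).const_add (σ : ℂ)
  have h2 := (hF.differentiableAt (isOpen_rightHalfPlane.mem_nhds hs)).hasDerivAt.comp (t : ℂ) h1
  rw [mul_comm] at h2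
  exact h2.comp_ofReal

/-- Green's formula for `(|f|² + δ)^(p/2)` with `f` holomorphic in the half-plane. -/
theorem green_regPow {f : ℂ → ℂ} (hf : DifferentiableOn ℂ f rightHalfPlane) {p δ ε S T : ℝ}
    (hδ : 0 < δ) (hε : 0 < ε) (hεS : ε ≤ S) (hT : 0 ≤ T) :
    IntegrableOn (fun z : ℝ × ℝ => (z.1 - ε) *
      regLaplacian p δ (f (z.1 + z.2 * Complex.I)) (deriv f (z.1 + z.2 * Complex.I)))
      (Ioc ε S ×ˢ Ioc (-T) T) ∧
    ∫ z in Ioc ε S ×ˢ Ioc (-T) T, (z.1 - ε) *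
      regLaplacian p δ (f (z.1 + z.2 * Complex.I)) (deriv f (z.1 + z.2 * Complex.I)) =
      (∫ t in (-T)..T, ((S - ε) *
          regPowDeriv p δ (f (S + t * Complex.I)) (deriv f (S + t * Complex.I)) -
        regPow p δ (f (S + t * Complex.I)) + regPow p δ (f (ε + t * Complex.I)))) +
      ∫ σ in ε..S, (σ - ε) *
        (regPowDeriv p δ (f (σ + T * Complex.I)) (Complex.I * deriv f (σ + T * Complex.I)) -
          regPowDeriv p δ (f (σ + (-T : ℝ) * Complex.I))
            (Complex.I * deriv f (σ + (-T : ℝ) * Complex.I))) := by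
  have hf1 := hf.deriv isOpen_rightHalfPlane
  have hf2 := hf1.deriv isOpen_rightHalfPlane
  have hmap : MapsTo (fun z : ℝ × ℝ => (z.1 : ℂ) + z.2 * Complex.I) (Icc ε S ×ˢ univ)
      rightHalfPlane := by
    intro z hz
    have : ε ≤ z.1 := hz.1.1
    simpa [rightHalfPlane] using hε.trans_le this
  have hc : ∀ F : ℂ → ℂ, DifferentiableOn ℂ F rightHalfPlane →
      ContinuousOn (fun z : ℝ × ℝ => F (z.1 + z.2 * Complex.I)) (Icc ε S ×ˢ univ) := fun F hF =>
    hF.continuousOn.comp (by fun_prop) hmap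
  have hcTwo : ∀ {w v b : ℝ × ℝ → ℂ} {s : Set (ℝ × ℝ)}, ContinuousOn w s → ContinuousOn v s →
      ContinuousOn b s → ContinuousOn (fun z => regPowDerivTwo p δ (w z) (v z) (b z)) s := by
    intro w v b s hw hv hb
    have hq : ∀ r : ℝ, ContinuousOn (fun z => (‖w z‖ ^ 2 + δ) ^ r) s := fun r =>
      ContinuousOn.rpow_const (by fun_prop) fun z _ => Or.inl (by positivity)
    have h1 := hq (p / 2 - 1)
    have h2 := hq (p / 2 - 2)
    have h3 : ContinuousOn (fun z => inner ℝ (w z) (v z)) s := hw.inner hv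
    have h4 : ContinuousOn (fun z => inner ℝ (w z) (b z)) s := hw.inner hb
    unfold regPowDerivTwo
    fun_prop
  have key := green_rectangle (T := T) hεS hT
    (u := fun σ t => regPow p δ (f (σ + t * Complex.I)))
    (uσ := fun σ t => regPowDeriv p δ (f (σ + t * Complex.I)) (deriv f (σ + t * Complex.I)))
    (ut := fun σ t => regPowDeriv p δ (f (σ + t * Complex.I))
      (Complex.I * deriv f (σ + t * Complex.I)))
    (uσσ := fun σ t => regPowDerivTwo p δ (f (σ + t * Complex.I)) (deriv f (σ + t * Complex.I))
      (deriv (deriv f) (σ + t * Complex.I)))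
    (utt := fun σ t => regPowDerivTwo p δ (f (σ + t * Complex.I))
      (Complex.I * deriv f (σ + t * Complex.I))
      (Complex.I * (Complex.I * deriv (deriv f) (σ + t * Complex.I))))
    (fun σ hσ t => hasDerivAt_regPow hδ (hasDerivAt_horizontal hf (hε.trans_le hσ.1)))
    (fun σ hσ t => hasDerivAt_regPowDeriv hδ (hasDerivAt_horizontal hf (hε.trans_le hσ.1))
      (hasDerivAt_horizontal hf1 (hε.trans_le hσ.1)))
    (fun σ hσ t => hasDerivAt_regPowDeriv hδ (hasDerivAt_vertical hf (hε.trans_le hσ.1))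
      ((hasDerivAt_vertical hf1 (hε.trans_le hσ.1)).const_mul Complex.I))
    (hcTwo (hc f hf) (hc _ hf1) (hc _ hf2))
    (hcTwo (hc f hf) (continuousOn_const.mul (hc _ hf1))
      (continuousOn_const.mul (continuousOn_const.mul (hc _ hf2))))
  simpa only [regPowDerivTwo_add hδ] using key

/-! ### Integrability by Fatou's lemma and the zero set -/

theorem one_div_natCast_add_one_le_one (n : ℕ) : 1 / ((n : ℝ) + 1) ≤ 1 := by
  rw [div_le_one (by positivity)]
  linarith [n.cast_nonneg (α := ℝ)]

/-- Fatou's lemma as an integrability criterion. -/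
theorem integrable_of_tendsto_of_integral_le {α : Type*} [MeasurableSpace α] {μ : Measure α}
    {G : ℕ → α → ℝ} {g : α → ℝ} {B : ℝ} (hG : ∀ n, Integrable (G n) μ)
    (hG0 : ∀ n, 0 ≤ᵐ[μ] G n) (hB : ∀ n, ∫ x, G n x ∂μ ≤ B)
    (hlim : ∀ᵐ x ∂μ, Tendsto (fun n => G n x) atTop (𝓝 (g x))) : Integrable g μ := by
  refine ⟨aestronglyMeasurable_of_tendsto_ae _ (fun n => (hG n).1) hlim, ?_⟩
  rw [hasFiniteIntegral_iff_enorm]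
  have h1 : ∫⁻ x, ‖g x‖ₑ ∂μ ≤ liminf (fun n => ∫⁻ x, ‖G n x‖ₑ ∂μ) atTop := by
    rw [lintegral_congr_ae (g := fun x => liminf (fun n => ‖G n x‖ₑ) atTop)
      (hlim.mono fun x hx => hx.enorm.liminf_eq.symm)]
    exact lintegral_liminf_le' fun n => (hG n).1.enorm
  refine (h1.trans (liminf_le_of_le (by isBoundedDefault) fun b hb => ?_)).trans_lt
    (ENNReal.ofReal_lt_top (r := B))
  obtain ⟨n, hn⟩ := hb.exists
  refine hn.trans ?_
  rw [← ofReal_integral_norm_eq_lintegral_enorm (hG n),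
    integral_congr_ae ((hG0 n).mono fun x hx => Real.norm_of_nonneg hx)]
  exact ENNReal.ofReal_le_ofReal (hB n)

/-- The zeros of a holomorphic function form a null set, unless the function vanishes
identically. -/
theorem ae_ne_zero_or_deriv_eq_zero {f : ℂ → ℂ} (hf : DifferentiableOn ℂ f rightHalfPlane) :
    ∀ᵐ z : ℝ × ℝ, 0 < z.1 → f (z.1 + z.2 * Complex.I) ≠ 0 ∨
      deriv f (z.1 + z.2 * Complex.I) = 0 := by
  have han := hf.analyticOnNhd isOpen_rightHalfPlane
  have h : ∀ᵐ s : ℂ, s ∈ rightHalfPlane → f s ≠ 0 ∨ deriv f s = 0 := by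
    rcases han.eqOn_zero_or_eventually_ne_zero_of_preconnected
      convex_rightHalfPlane.isPreconnected with h0 | h0
    · refine ae_of_all _ fun s hs => Or.inr ?_
      have : f =ᶠ[𝓝 s] fun _ => 0 := h0.eventuallyEq_of_mem (isOpen_rightHalfPlane.mem_nhds hs)
      rw [this.deriv_eq, deriv_const]
    · have h1 := ae_restrict_le_codiscreteWithin (μ := volume)
        isOpen_rightHalfPlane.measurableSet h0
      exact ((ae_restrict_iff' isOpen_rightHalfPlane.measurableSet).1 h1).mono
        fun s hs hs' => Or.inl (hs hs')
  have h2 := Complex.volume_preserving_equiv_real_prod.symm.quasiMeasurePreserving.ae h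
  filter_upwards [h2] with z hz hz0
  have hz' : Complex.measurableEquivRealProd.symm z = (z.1 : ℂ) + z.2 * Complex.I := by
    apply Complex.ext <;> simp
  rw [hz'] at hz
  exact hz (by simpa [rightHalfPlane] using hz0)

/-! ### Approximation of the Littlewood-Paley density -/

/-- The regularized Littlewood-Paley density `(σ - ε) Δ (|f|² + ε)^(p/2)`, with `ε = 1 / (n + 1)`,
cut off to `ε < σ ≤ n + 1`. -/
noncomputable def approxDensity (p : ℝ) (f : ℂ → ℂ) (n : ℕ) : ℝ × ℝ → ℝ :=
  (Ioc (1 / ((n : ℝ) + 1)) ((n : ℝ) + 1) ×ˢ univ).indicator fun z =>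
    (z.1 - 1 / ((n : ℝ) + 1)) * regLaplacian p (1 / ((n : ℝ) + 1))
      (f (z.1 + z.2 * Complex.I)) (deriv f (z.1 + z.2 * Complex.I))

theorem approxDensity_nonneg {p : ℝ} (hp : 0 ≤ p) (f : ℂ → ℂ) (n : ℕ) (z : ℝ × ℝ) :
    0 ≤ approxDensity p f n z := by
  refine indicator_nonneg (fun z hz => ?_) z
  exact mul_nonneg (sub_nonneg.2 hz.1.1.le) (regLaplacian_nonneg hp (by positivity) _ _)

theorem tendsto_approxDensity {p : ℝ} {f : ℂ → ℂ} {z : ℝ × ℝ} (hz : 0 < z.1)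
    (h : f (z.1 + z.2 * Complex.I) ≠ 0 ∨ deriv f (z.1 + z.2 * Complex.I) = 0) :
    Tendsto (fun n => approxDensity p f n z) atTop (𝓝 (p ^ 2 * lpDensity p f z.1 z.2)) := by
  have hε := tendsto_one_div_add_atTop_nhds_zero_nat (𝕜 := ℝ)
  have h1 := (hε.const_sub z.1).mul (tendsto_regLaplacian (p := p) h hε)
  rw [sub_zero, show z.1 * (p ^ 2 * (‖f (z.1 + z.2 * Complex.I)‖ ^ (p - 2) *
    ‖deriv f (z.1 + z.2 * Complex.I)‖ ^ 2)) = p ^ 2 * lpDensity p f z.1 z.2 by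
      rw [lpDensity]; ring] at h1
  refine h1.congr' ?_
  filter_upwards [hε.eventually (gt_mem_nhds hz),
    (tendsto_natCast_atTop_atTop (R := ℝ)).eventually (eventually_ge_atTop z.1)] with n hn1 hn2
  have hmem : z ∈ Ioc (1 / ((n : ℝ) + 1)) ((n : ℝ) + 1) ×ˢ (univ : Set ℝ) :=
    ⟨⟨hn1, by linarith⟩, mem_univ _⟩
  rw [approxDensity, indicator_of_mem hmem]

theorem approxDensity_le {p : ℝ} (hp : 0 ≤ p) {f : ℂ → ℂ} {z : ℝ × ℝ} (hz : 0 < z.1) (n : ℕ) :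
    approxDensity p f n z ≤ z.1 * ((p ^ 2 + 2 * p) *
      ((‖f (z.1 + z.2 * Complex.I)‖ ^ 2 + 1 / ((n : ℝ) + 1)) ^ (p / 2 - 1) *
        ‖deriv f (z.1 + z.2 * Complex.I)‖ ^ 2)) := by
  have hε : (0 : ℝ) < 1 / ((n : ℝ) + 1) := by positivity
  rw [approxDensity, indicator_apply]
  split_ifs
  · have := regLaplacian_le hp hε (f (z.1 + z.2 * Complex.I)) (deriv f (z.1 + z.2 * Complex.I))
    have h2 := regLaplacian_nonneg hp hε.le (f (z.1 + z.2 * Complex.I))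
      (deriv f (z.1 + z.2 * Complex.I))
    gcongr
    linarith
  · positivity

/-- For `p ≤ 2` the regularized densities are dominated by the density of exponent `p` itself; for
`p ≥ 2` the zeros of `f` do no harm and the density of exponent `2` suffices. -/
theorem approxDensity_le_lpDensity_min {p M : ℝ} (hp : 0 ≤ p) {f : ℂ → ℂ} {z : ℝ × ℝ} (hz : 0 < z.1)
    (hM : ‖f (z.1 + z.2 * Complex.I)‖ ≤ M)
    (h : f (z.1 + z.2 * Complex.I) ≠ 0 ∨ deriv f (z.1 + z.2 * Complex.I) = 0) (n : ℕ) :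
    approxDensity p f n z ≤
      (p ^ 2 + 2 * p) * (M ^ 2 + 1) ^ ((p - min p 2) / 2) * lpDensity (min p 2) f z.1 z.2 := by
  refine (approxDensity_le hp hz n).trans ?_
  rw [lpDensity]
  rcases h with h | h
  · set w := f (z.1 + z.2 * Complex.I)
    set m := min p 2
    have hw : 0 < ‖w‖ := norm_pos_iff.2 h
    have hε : (0 : ℝ) < 1 / ((n : ℝ) + 1) := by positivity
    have hε1 : 1 / ((n : ℝ) + 1) ≤ 1 := one_div_natCast_add_one_le_one n
    have hq : 0 < ‖w‖ ^ 2 + 1 / ((n : ℝ) + 1) := by positivity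
    have hmp : 0 ≤ p - m := sub_nonneg.2 (min_le_left _ _)
    have hm2 : m ≤ 2 := min_le_right _ _
    have key : (‖w‖ ^ 2 + 1 / ((n : ℝ) + 1)) ^ (p / 2 - 1) ≤
        (M ^ 2 + 1) ^ ((p - m) / 2) * ‖w‖ ^ (m - 2) := by
      calc (‖w‖ ^ 2 + 1 / ((n : ℝ) + 1)) ^ (p / 2 - 1)
          = (‖w‖ ^ 2 + 1 / ((n : ℝ) + 1)) ^ ((p - m) / 2) *
              (‖w‖ ^ 2 + 1 / ((n : ℝ) + 1)) ^ ((m - 2) / 2) := by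
            rw [← Real.rpow_add hq]
            ring_nf
        _ ≤ (M ^ 2 + 1) ^ ((p - m) / 2) * (‖w‖ ^ 2) ^ ((m - 2) / 2) := by
            gcongr ?_ * ?_
            · gcongr
            · exact Real.rpow_le_rpow_of_nonpos (by positivity) (by linarith) (by linarith)
        _ = _ := by
            rw [← Real.rpow_natCast ‖w‖ 2, ← Real.rpow_mul hw.le]
            congr 2
            push_cast
            ring
    calc _ ≤ z.1 * ((p ^ 2 + 2 * p) * ((M ^ 2 + 1) ^ ((p - m) / 2) * ‖w‖ ^ (m - 2) *
          ‖deriv f (z.1 + z.2 * Complex.I)‖ ^ 2)) := by gcongr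
      _ = _ := by ring
  · simp [h]

/-! ### The boundary terms -/

/-- The contribution of the vertical sides to Green's formula for the regularized density. -/
noncomputable def sideTerm (p : ℝ) (f : ℂ → ℂ) (n : ℕ) (t : ℝ) : ℝ :=
  ((n : ℝ) + 1 - 1 / ((n : ℝ) + 1)) *
      regPowDeriv p (1 / ((n : ℝ) + 1)) (f (((n : ℝ) + 1 : ℝ) + t * Complex.I))
        (deriv f (((n : ℝ) + 1 : ℝ) + t * Complex.I)) -
    regPow p (1 / ((n : ℝ) + 1)) (f (((n : ℝ) + 1 : ℝ) + t * Complex.I)) +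
    regPow p (1 / ((n : ℝ) + 1)) (f ((1 / ((n : ℝ) + 1) : ℝ) + t * Complex.I))

/-- The contribution of the horizontal sides is bounded uniformly in the height `T`. -/
theorem exists_abs_integral_approxDensity_sub_le {f : ℂ → ℂ}
    (hf : DifferentiableOn ℂ f rightHalfPlane) {p K M : ℝ} (hp : 1 ≤ p) (hK0 : 0 ≤ K)
    (hM : ∀ s ∈ rightHalfPlane, ‖f s‖ ≤ M)
    (hK : ∀ s ∈ rightHalfPlane, s.re * ‖deriv f s‖ ≤ K * Real.exp (-s.re / 4)) :
    ∃ C : ℝ, ∀ T : ℝ, 0 ≤ T → ∀ n : ℕ,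
      IntegrableOn (approxDensity p f n) (Ioi 0 ×ˢ Ioc (-T) T) ∧
      |(∫ z in Ioi 0 ×ˢ Ioc (-T) T, approxDensity p f n z) -
        ∫ t in (-T)..T, sideTerm p f n t| ≤ C := by
  set D : ℝ := 2 * (p * (M ^ 2 + 1) ^ ((p - 1) / 2) * K) with hD
  have hD0 : 0 ≤ D := by positivity
  have hDint : IntegrableOn (fun σ : ℝ => D * Real.exp (-(1 / 4) * σ)) (Ioi 0) :=
    (integrableOn_exp_mul_Ioi (by norm_num) 0).const_mul D
  refine ⟨∫ σ in Ioi (0 : ℝ), D * Real.exp (-(1 / 4) * σ), fun T hT n => ?_⟩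
  have hε : (0 : ℝ) < 1 / ((n : ℝ) + 1) := by positivity
  have hε1 : 1 / ((n : ℝ) + 1) ≤ 1 := one_div_natCast_add_one_le_one n
  have hεS : 1 / ((n : ℝ) + 1) ≤ (n : ℝ) + 1 := hε1.trans (by linarith [n.cast_nonneg (α := ℝ)])
  obtain ⟨hint, heq⟩ := green_regPow hf (p := p) hε hε hεS hT
  have hinter : (Ioi (0 : ℝ) ×ˢ Ioc (-T) T) ∩
      (Ioc (1 / ((n : ℝ) + 1)) ((n : ℝ) + 1) ×ˢ univ) =
      Ioc (1 / ((n : ℝ) + 1)) ((n : ℝ) + 1) ×ˢ Ioc (-T) T := by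
    rw [prod_inter_prod, inter_univ, inter_eq_right.2]
    exact fun x hx => hε.trans hx.1
  have hms : MeasurableSet (Ioc (1 / ((n : ℝ) + 1)) ((n : ℝ) + 1) ×ˢ (univ : Set ℝ)) :=
    measurableSet_Ioc.prod MeasurableSet.univ
  refine ⟨?_, ?_⟩
  · unfold approxDensity
    rw [IntegrableOn, integrable_indicator_iff hms, IntegrableOn, Measure.restrict_restrict hms,
      inter_comm, hinter]
    exact hint
  unfold approxDensity
  rw [setIntegral_indicator hms, hinter, heq]
  unfold sideTerm
  rw [add_sub_cancel_left, intervalIntegral.integral_of_le hεS, ← Real.norm_eq_abs]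
  have hbound : ∀ σ : ℝ, 1 / ((n : ℝ) + 1) < σ → ∀ t : ℝ,
      (σ - 1 / ((n : ℝ) + 1)) * ‖regPowDeriv p (1 / ((n : ℝ) + 1)) (f (σ + t * Complex.I))
        (Complex.I * deriv f (σ + t * Complex.I))‖ ≤ D / 2 * Real.exp (-(1 / 4) * σ) := by
    intro σ hσ t
    have hs : (σ : ℂ) + t * Complex.I ∈ rightHalfPlane := by
      simpa [rightHalfPlane] using hε.trans hσ
    have hre : ((σ : ℂ) + t * Complex.I).re = σ := by simp
    have h1 := norm_regPowDeriv_le hp hε hε1 (hM _ hs) (Complex.I * deriv f (σ + t * Complex.I))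
    have h2 := hK _ hs
    rw [hre, show -σ / 4 = -(1 / 4) * σ by ring] at h2
    rw [norm_mul, Complex.norm_I, one_mul] at h1
    calc _ ≤ σ * (p * (M ^ 2 + 1) ^ ((p - 1) / 2) * ‖deriv f (σ + t * Complex.I)‖) := by
          have : 0 < σ := hε.trans hσ
          gcongr
          linarith
      _ = p * (M ^ 2 + 1) ^ ((p - 1) / 2) * (σ * ‖deriv f (σ + t * Complex.I)‖) := by ring
      _ ≤ p * (M ^ 2 + 1) ^ ((p - 1) / 2) * (K * Real.exp (-(1 / 4) * σ)) := by gcongr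
      _ = _ := by rw [hD]; ring
  refine (norm_integral_le_of_norm_le (hDint.mono_set fun x hx => hε.trans hx.1)
    ((ae_restrict_iff' measurableSet_Ioc).2 (ae_of_all _ fun σ hσ => ?_))).trans
    (setIntegral_mono_set hDint (ae_of_all _ fun σ => by positivity)
      (LE.le.eventuallyLE fun x hx => hε.trans hx.1))
  have hσ0 : 0 ≤ σ - 1 / ((n : ℝ) + 1) := sub_nonneg.2 hσ.1.le
  rw [norm_mul, Real.norm_of_nonneg hσ0]
  calc _ ≤ (σ - 1 / ((n : ℝ) + 1)) * (_ + _) :=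
        mul_le_mul_of_nonneg_left (norm_sub_le _ _) hσ0
    _ ≤ D / 2 * Real.exp (-(1 / 4) * σ) + D / 2 * Real.exp (-(1 / 4) * σ) := by
        rw [mul_add]
        exact add_le_add (hbound σ hσ.1 T) (hbound σ hσ.1 (-T))
    _ = _ := by ring

theorem intervalIntegrable_norm_boundaryValue_rpow {f : ℂ → ℂ}
    (hf : DifferentiableOn ℂ f rightHalfPlane) {p M : ℝ} (hp : 0 ≤ p)
    (hM : ∀ s ∈ rightHalfPlane, ‖f s‖ ≤ M)
    (hbv : ∀ᵐ τ : ℝ, Tendsto (fun σ : ℝ => f ((σ : ℂ) + (τ : ℂ) * Complex.I)) (𝓝[>] (0 : ℝ))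
      (𝓝 (boundaryValue f τ))) (x y : ℝ) :
    IntervalIntegrable (fun τ : ℝ => ‖boundaryValue f τ‖ ^ p) volume x y := by
  have hmem : ∀ σ : ℝ, 0 < σ → ∀ t : ℝ, (σ : ℂ) + t * Complex.I ∈ rightHalfPlane := fun σ hσ t => by
    simpa [rightHalfPlane] using hσ
  have hmeas : AEStronglyMeasurable (boundaryValue f) volume := by
    refine aestronglyMeasurable_of_tendsto_ae (𝓝[>] (0 : ℝ))
      (f := fun (σ : ℝ) (t : ℝ) => if 0 < σ then f (σ + t * Complex.I) else 0) (fun σ => ?_) ?_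
    · split_ifs with h
      · exact (hf.continuousOn.comp_continuous (by fun_prop) (hmem σ h)).aestronglyMeasurable
      · exact aestronglyMeasurable_const
    · filter_upwards [hbv] with τ hτ
      refine hτ.congr' ?_
      filter_upwards [self_mem_nhdsWithin] with σ hσ
      exact (if_pos hσ).symm
  rw [intervalIntegrable_iff]
  refine Measure.integrableOn_of_bounded (M := M ^ p) (by simp) ?_ ?_
  · exact (hmeas.norm.aemeasurable.pow_const p).aestronglyMeasurable
  · refine ae_restrict_of_ae (hbv.mono fun τ hτ => ?_)
    have : ‖boundaryValue f τ‖ ≤ M := by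
      refine le_of_tendsto hτ.norm ?_
      filter_upwards [self_mem_nhdsWithin] with σ hσ
      exact hM _ (hmem σ hσ τ)
    rw [Real.norm_of_nonneg (by positivity)]
    gcongr

/-- The derivative term on `σ = n + 1` vanishes in the limit; the other two tend to the boundary
value at `+∞` and on the imaginary axis. -/
theorem tendsto_integral_sideTerm {f : ℂ → ℂ} {c : ℂ}
    (hf : DifferentiableOn ℂ f rightHalfPlane) {p K K' M : ℝ} (hp : 1 ≤ p) (hK0 : 0 ≤ K)
    (hM : ∀ s ∈ rightHalfPlane, ‖f s‖ ≤ M)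
    (hK : ∀ s ∈ rightHalfPlane, s.re * ‖deriv f s‖ ≤ K * Real.exp (-s.re / 4))
    (hK' : ∀ s ∈ rightHalfPlane, ‖f s - c‖ ≤ K' * Real.exp (-s.re / 2))
    (hbv : ∀ᵐ τ : ℝ, Tendsto (fun σ : ℝ => f ((σ : ℂ) + (τ : ℂ) * Complex.I)) (𝓝[>] (0 : ℝ))
      (𝓝 (boundaryValue f τ))) (T : ℝ) :
    Tendsto (fun n => ∫ t in (-T)..T, sideTerm p f n t) atTop
      (𝓝 ((∫ τ in (-T)..T, ‖boundaryValue f τ‖ ^ p) - 2 * T * ‖c‖ ^ p)) := by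
  have hmem : ∀ σ : ℝ, 0 < σ → ∀ t : ℝ, (σ : ℂ) + t * Complex.I ∈ rightHalfPlane := fun σ hσ t => by
    simpa [rightHalfPlane] using hσ
  have hε0 : ∀ n : ℕ, (0 : ℝ) < 1 / ((n : ℝ) + 1) := fun n => by positivity
  have hε1 : ∀ n : ℕ, 1 / ((n : ℝ) + 1) ≤ 1 := fun n => one_div_natCast_add_one_le_one n
  have hS0 : ∀ n : ℕ, 0 < (n : ℝ) + 1 := fun n => by positivity
  have hε := tendsto_one_div_add_atTop_nhds_zero_nat (𝕜 := ℝ)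
  have hS : Tendsto (fun n : ℕ => (n : ℝ) + 1) atTop atTop :=
    tendsto_atTop_add_const_right _ _ tendsto_natCast_atTop_atTop
  have hexp : ∀ b : ℝ, 0 < b → Tendsto (fun n : ℕ => Real.exp (-((n : ℝ) + 1) / b)) atTop (𝓝 0) :=
    fun b hb => Real.tendsto_exp_atBot.comp
      ((tendsto_neg_atTop_atBot.comp hS).atBot_div_const hb)
  have hre : ∀ σ t : ℝ, ((σ : ℂ) + t * Complex.I).re = σ := fun σ t => by simp
  set B : ℝ := p * (M ^ 2 + 1) ^ ((p - 1) / 2) with hB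
  have hB0 : 0 ≤ B := by positivity
  have hfirst : ∀ (n : ℕ) (t : ℝ), ‖((n : ℝ) + 1 - 1 / ((n : ℝ) + 1)) *
      regPowDeriv p (1 / ((n : ℝ) + 1)) (f (((n : ℝ) + 1 : ℝ) + t * Complex.I))
        (deriv f (((n : ℝ) + 1 : ℝ) + t * Complex.I))‖ ≤
      B * (K * Real.exp (-((n : ℝ) + 1) / 4)) := by
    intro n t
    have h1 := norm_regPowDeriv_le hp (hε0 n) (hε1 n) (hM _ (hmem _ (hS0 n) t))
      (deriv f (((n : ℝ) + 1 : ℝ) + t * Complex.I))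
    have h2 := hK _ (hmem _ (hS0 n) t)
    rw [hre] at h2
    have h3 : 0 ≤ (n : ℝ) + 1 - 1 / ((n : ℝ) + 1) := by
      linarith [hε1 n, n.cast_nonneg (α := ℝ)]
    rw [norm_mul, Real.norm_of_nonneg h3]
    calc _ ≤ ((n : ℝ) + 1) * (B * ‖deriv f (((n : ℝ) + 1 : ℝ) + t * Complex.I)‖) := by
          gcongr
          linarith [hε0 n]
      _ = B * (((n : ℝ) + 1) * ‖deriv f (((n : ℝ) + 1 : ℝ) + t * Complex.I)‖) := by ring
      _ ≤ _ := by gcongr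
  have hcont : ∀ n, Continuous (sideTerm p f n) := by
    intro n
    have hc : ∀ σ : ℝ, 0 < σ → Continuous fun t : ℝ => f (σ + t * Complex.I) := fun σ hσ =>
      hf.continuousOn.comp_continuous (by fun_prop) (hmem σ hσ)
    have hc' : ∀ σ : ℝ, 0 < σ → Continuous fun t : ℝ => deriv f (σ + t * Complex.I) := fun σ hσ =>
      (hf.deriv isOpen_rightHalfPlane).continuousOn.comp_continuous (by fun_prop) (hmem σ hσ)
    have hpow : ∀ (r : ℝ) (w : ℝ → ℂ), Continuous w →
        Continuous fun t => (‖w t‖ ^ 2 + 1 / ((n : ℝ) + 1)) ^ r := fun r w hw =>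
      Continuous.rpow_const (by fun_prop) fun t => Or.inl (by have := hε0 n; positivity)
    have h1 := hpow (p / 2) _ (hc _ (hε0 n))
    have h2 := hpow (p / 2) _ (hc _ (hS0 n))
    have h3 := hpow (p / 2 - 1) _ (hc _ (hS0 n))
    have h4 := (hc _ (hS0 n)).inner (𝕜 := ℝ) (hc' _ (hS0 n))
    unfold sideTerm regPowDeriv regPow
    exact ((continuous_const.mul ((continuous_const.mul h3).mul h4)).sub h2).add h1
  have hval : (∫ τ in (-T)..T, ‖boundaryValue f τ‖ ^ p) - 2 * T * ‖c‖ ^ p =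
      ∫ τ in (-T)..T, (0 - ‖c‖ ^ p + ‖boundaryValue f τ‖ ^ p) := by
    rw [intervalIntegral.integral_add intervalIntegrable_const
      (intervalIntegrable_norm_boundaryValue_rpow hf (by linarith) hM hbv _ _),
      intervalIntegral.integral_const, smul_eq_mul]
    ring
  rw [hval]
  refine intervalIntegral.tendsto_integral_filter_of_dominated_convergence
    (fun _ => B * K + (M ^ 2 + 1) ^ (p / 2) + (M ^ 2 + 1) ^ (p / 2))
    (Eventually.of_forall fun n => (hcont n).aestronglyMeasurable)
    (Eventually.of_forall fun n => ae_of_all _ fun t _ => ?_) intervalIntegrable_const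
    (hbv.mono fun t ht _ => ?_)
  · refine (norm_add_le _ _).trans (add_le_add ((norm_sub_le _ _).trans (add_le_add ?_ ?_)) ?_)
    · refine (hfirst n t).trans ?_
      gcongr
      refine mul_le_of_le_one_right hK0 (Real.exp_le_one_iff.2 ?_)
      linarith [hS0 n]
    · exact norm_regPow_le (by linarith) (hε0 n).le (hε1 n) (hM _ (hmem _ (hS0 n) t))
    · exact norm_regPow_le (by linarith) (hε0 n).le (hε1 n) (hM _ (hmem _ (hε0 n) t))
  · refine (Tendsto.sub ?_ ?_).add ?_
    · refine squeeze_zero_norm (fun n => hfirst n t) ?_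
      simpa using ((hexp 4 (by norm_num)).const_mul K).const_mul B
    · refine tendsto_regPow (by linarith) ?_ hε
      refine tendsto_iff_norm_sub_tendsto_zero.2
        (squeeze_zero (fun n => norm_nonneg _) (fun n => hK' _ (hmem _ (hS0 n) t)) ?_)
      simp only [hre]
      simpa using (hexp 2 (by norm_num)).const_mul K'
    · refine tendsto_regPow (by linarith) ?_ hε
      exact ht.comp (tendsto_nhdsWithin_iff.2 ⟨hε, Eventually.of_forall hε0⟩)

/-! ### The Littlewood-Paley identity -/

/-- The density of exponent `p` is integrable on `{σ > 0, |t| ≤ T}`, and the Littlewood-Paley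
identity holds there up to an error that does not depend on `T`. -/
theorem MemHInfty.exists_littlewoodPaley_bound {f : ℂ → ℂ} (hf : MemHInfty f) {a : ℕ → ℂ}
    (ha : HasDirichletSeries f a) {p : ℝ} (hp : 1 ≤ p) :
    ∃ C : ℝ, ∀ T : ℝ, 0 ≤ T →
      IntegrableOn (fun z : ℝ × ℝ => lpDensity p f z.1 z.2) (Ioi 0 ×ˢ Ioc (-T) T) ∧
      |(p ^ 2 * ∫ z in Ioi 0 ×ˢ Ioc (-T) T, lpDensity p f z.1 z.2) -
        ((∫ τ in (-T)..T, ‖boundaryValue f τ‖ ^ p) - 2 * T * ‖a 1‖ ^ p)| ≤ C := by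
  have hd : DifferentiableOn ℂ f rightHalfPlane := hf.analytic
  obtain ⟨M, hM⟩ := hf.bounded
  obtain ⟨K', hK'0, hK'⟩ := hf.exists_decay ha
  have hK := fun s hs => re_mul_norm_deriv_le hd hK'0 hK' (s := s) hs
  have hK0 : 0 ≤ 2 * K' := by positivity
  have hbv := hf.ae_tendsto_boundaryValue
  have hstrip : ∀ T : ℝ, MeasurableSet (Ioi (0 : ℝ) ×ˢ Ioc (-T) T) := fun T =>
    measurableSet_Ioi.prod measurableSet_Ioc
  have hzero : ∀ T : ℝ, ∀ᵐ z : ℝ × ℝ ∂volume.restrict (Ioi (0 : ℝ) ×ˢ Ioc (-T) T), 0 < z.1 ∧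
      (f (z.1 + z.2 * Complex.I) ≠ 0 ∨ deriv f (z.1 + z.2 * Complex.I) = 0) := by
    intro T
    rw [ae_restrict_iff' (hstrip T)]
    filter_upwards [ae_ne_zero_or_deriv_eq_zero hd] with z hz hz'
    exact ⟨hz'.1, hz hz'.1⟩
  have hlim : ∀ q T : ℝ, ∀ᵐ z : ℝ × ℝ ∂volume.restrict (Ioi (0 : ℝ) ×ˢ Ioc (-T) T),
      Tendsto (fun n => approxDensity q f n z) atTop (𝓝 (q ^ 2 * lpDensity q f z.1 z.2)) :=
    fun q T => (hzero T).mono fun z hz => tendsto_approxDensity hz.1 hz.2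
  have hside := fun q (hq : 1 ≤ q) => tendsto_integral_sideTerm hd hq hK0 hM hK hK' hbv
  have hintegrable : ∀ q : ℝ, 1 ≤ q → ∀ T : ℝ, 0 ≤ T →
      IntegrableOn (fun z : ℝ × ℝ => lpDensity q f z.1 z.2) (Ioi 0 ×ˢ Ioc (-T) T) := by
    intro q hq T hT
    obtain ⟨C, hC⟩ := exists_abs_integral_approxDensity_sub_le hd hq hK0 hM hK
    obtain ⟨B, hB⟩ := (hside q hq T).bddAbove_range
    have h := integrable_of_tendsto_of_integral_le (B := B + C) (fun n => (hC T hT n).1)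
      (fun n => ae_of_all _ fun z => approxDensity_nonneg (by linarith) f n z) (fun n => by
        have h1 := (abs_le.1 (hC T hT n).2).2
        have h2 := hB ⟨n, rfl⟩
        simp only at h2
        linarith) (hlim q T)
    have hq2 : q ^ 2 ≠ 0 := by positivity
    refine (h.const_mul (q ^ 2)⁻¹).congr (ae_of_all _ fun z => ?_)
    exact inv_mul_cancel_left₀ hq2 _
  obtain ⟨C, hC⟩ := exists_abs_integral_approxDensity_sub_le hd hp hK0 hM hK
  refine ⟨C, fun T hT => ⟨hintegrable p hp T hT, ?_⟩⟩
  -- only integrability of the dominating density enters, and Fatou's lemma gives it for every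
  -- exponent `≥ 1`, in particular for `min p 2`
  have hdom : Tendsto (fun n => ∫ z in Ioi 0 ×ˢ Ioc (-T) T, approxDensity p f n z) atTop
      (𝓝 (∫ z in Ioi 0 ×ˢ Ioc (-T) T, p ^ 2 * lpDensity p f z.1 z.2)) := by
    refine tendsto_integral_of_dominated_convergence
      (fun z : ℝ × ℝ => (p ^ 2 + 2 * p) * (M ^ 2 + 1) ^ ((p - min p 2) / 2) *
        lpDensity (min p 2) f z.1 z.2) (fun n => (hC T hT n).1.1)
      ((hintegrable (min p 2) (le_min hp one_le_two) T hT).const_mul _) (fun n => ?_) (hlim p T)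
    refine (hzero T).mono fun z hz => ?_
    rw [Real.norm_of_nonneg (approxDensity_nonneg (by linarith) f n z)]
    exact approxDensity_le_lpDensity_min (by linarith) hz.1
      (hM _ (by simpa using hz.1)) hz.2 n
  rw [integral_const_mul] at hdom
  exact le_of_tendsto (hdom.sub (hside p hp T)).abs
    (Eventually.of_forall fun n => (hC T hT n).2)

theorem theorem1p4 (p : ℝ) (hp : 1 ≤ p) (f : ℂ → ℂ) (hf : MemHInfty f)
    (a : ℕ → ℂ) (ha : HasDirichletSeries f a) :
    -- the boundary values exist almost everywhere, and all integrals below converge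
    (∀ᵐ τ : ℝ, Tendsto (fun σ : ℝ => f ((σ : ℂ) + (τ : ℂ) * Complex.I)) (𝓝[>] (0 : ℝ))
      (𝓝 (boundaryValue f τ))) ∧
    (∀ T : ℝ, 0 < T →
      IntervalIntegrable (fun τ : ℝ => ‖boundaryValue f τ‖ ^ p) volume (-T) T ∧
      IntegrableOn (fun z : ℝ × ℝ => lpDensity p f z.1 z.2) (Ioi (0 : ℝ) ×ˢ Ioc (-T) T) volume) ∧
    -- the value of `f` at `+∞` is the constant coefficient `a 1`
    Tendsto (fun T : ℝ =>
      |1 / (2 * T) * (∫ τ in (-T)..T, ‖boundaryValue f τ‖ ^ p) - ‖a 1‖ ^ p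
        - p ^ 2 / (2 * T) * (∫ σ in Ioi (0 : ℝ), ∫ t in (-T)..T, lpDensity p f σ t)|)
      atTop (𝓝 0) := by
  obtain ⟨C, hC⟩ := hf.exists_littlewoodPaley_bound ha hp
  obtain ⟨M, hM⟩ := hf.bounded
  have hbv := hf.ae_tendsto_boundaryValue
  refine ⟨hbv, fun T hT => ⟨intervalIntegrable_norm_boundaryValue_rpow hf.analytic
    (by linarith) hM hbv _ _, (hC T hT.le).1⟩, ?_⟩
  refine squeeze_zero' (Eventually.of_forall fun T => abs_nonneg _) ?_
    (tendsto_const_nhds.div_atTop (tendsto_id.const_mul_atTop two_pos) : Tendsto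
      (fun T : ℝ => C / (2 * T)) atTop (𝓝 0))
  filter_upwards [eventually_gt_atTop 0] with T hT
  obtain ⟨hint, hle⟩ := hC T hT.le
  rw [Measure.volume_eq_prod, setIntegral_prod _ hint] at hle
  simp only [← intervalIntegral.integral_of_le (by linarith : -T ≤ T)] at hle
  rw [le_div_iff₀ (by positivity), ← abs_of_pos (by positivity : 0 < 2 * T), ← abs_mul]
  refine le_trans (le_of_eq ?_) hle
  rw [← abs_neg]
  congr 1
  rw [abs_of_pos (by positivity : 0 < 2 * T)]
  field_simp
  ring
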